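/- Write $\mathbb{F}_2$ for the field with two elements. A GF(2)-grammar over the alphabet $\{a,b\}$ consists of a finite set $N$ of nonterminal symbols, an initial symbol $S \in N$, and a finite set of rules $C \to X_1 \cdots X_\ell$ with $C \in N$, $\ell \ge 0$ and $X_1,\dots,X_\ell \in \{a,b\} \cup N$, such that for every $C \in N$ every word $w \in \{a,b\}^*$ has only finitely many parse trees with root $C$ in the ordinary (context-free) grammar with these rules. It describes the language of all words $w$ for which the number of parse trees of $w$ with root $S$ is odd. For a language $L \subseteq a^*b^*$ let $\mathrm{Dual}(L) = \sum_{a^n b^m \in L} a^n b^m \in \mathbb{F}_2[[a,b]]$, where $a$ and $b$ are now commuting variables; $\mathrm{Dual}$ is a bijection from the set of all languages $L \subseteq a^*b^*$ onto $\mathbb{F}_2[[a,b]]$. Let $\mathcal{A} \subseteq \mathbb{F}_2[[a]]$ be the set of all power series in $a$ that are algebraic, that is, that are a root of some nonzero polynomial with coefficients in $\mathbb{F}_2[a]$, and define $\mathcal{B} \subseteq \mathbb{F}_2[[b]]$ similarly. Let $R_{a,b}^{int}$ be the set of all elements of the field of fractions of $\mathbb{F}_2[[a,b]]$ that can be represented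 as $$\frac{\sum_{i=1}^n A_i B_i}{p},$$ where $n \ge 0$, $A_i \in \mathcal{A}$ and $B_i \in \mathcal{B}$ for all $i$ from $1$ to $n$, and $p \in \mathbb{F}_2[a,b]$ is a polynomial with constant term equal to $1$. **Theorem.** If $f \in R_{a,b}^{int}$, then $f \in \mathbb{F}_2[[a,b]]$, and the language $\mathrm{Dual}^{-1}(f) \subseteq a^*b^*$ is described by a GF(2)-grammar over $\{a,b\}$. -/

import Mathlib

noncomputable section

/-! ### GF(2)-grammars -/

mutual

/-- Parse trees of an ordinary (context-free) grammar with a given root symbol: a leaf carries a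
terminal symbol, and an inner node carries a nonterminal symbol `A` together with a rule
`A → α` of the grammar and a sequence of subtrees, one for each symbol of `α`, in order. -/
inductive ParseTree {T : Type} (G : ContextFreeGrammar T) : Symbol T G.NT → Type
  | leaf (t : T) : ParseTree G (.terminal t)
  | node (A : G.NT) (α : List (Symbol T G.NT)) (h : ContextFreeRule.mk A α ∈ G.rules)
      (children : ParseForest G α) : ParseTree G (.nonterminal A)

/-- Sequences of parse trees whose sequence of root symbols is the given one. -/
inductive ParseForest {T : Type} (G : ContextFreeGrammar T) : List (Symbol T G.NT) → Type
  | nil : ParseForest G []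
  | cons (X : Symbol T G.NT) (α : List (Symbol T G.NT)) (t : ParseTree G X)
      (ts : ParseForest G α) : ParseForest G (X :: α)

end

mutual

/-- The word spelled by the leaves of a parse tree, from left to right. -/
def ParseTree.yield {T : Type} {G : ContextFreeGrammar T} {X : Symbol T G.NT} :
    ParseTree G X → List T
  | .leaf t => [t]
  | .node _ _ _ children => children.yield

/-- The word spelled by the leaves of a sequence of parse trees, from left to right. -/
def ParseForest.yield {T : Type} {G : ContextFreeGrammar T} {α : List (Symbol T G.NT)} :
    ParseForest G α → List T
  | .nil => []
  | .cons _ _ t ts => t.yield ++ ts.yield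

end

/-- The parse trees of the word `w` as the nonterminal `A`. -/
def ParseTreesOf {T : Type} (G : ContextFreeGrammar T) (A : G.NT) (w : List T) : Type :=
  {t : ParseTree G (.nonterminal A) // t.yield = w}

/-- A GF(2)-grammar over the alphabet `T`: syntactically an ordinary grammar (finitely many
nonterminals, finitely many rules), in which every word has only finitely many parse trees as
each nonterminal. -/
structure GF2Grammar (T : Type) extends ContextFreeGrammar T where
  finite_NT : Finite NT
  finite_parseTrees : ∀ (A : NT) (w : List T), Finite (ParseTreesOf toContextFreeGrammar A w)

/-- The language `L_G(A)` of all words with an odd number of parse trees as `A`. -/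
def GF2Grammar.languageOf {T : Type} (G : GF2Grammar T) (A : G.NT) : Language T :=
  {w | Odd (Nat.card (ParseTreesOf G.toContextFreeGrammar A w))}

/-- The language described by a GF(2)-grammar: the language of its initial symbol. -/
def GF2Grammar.language {T : Type} (G : GF2Grammar T) : Language T :=
  G.languageOf G.initial

/-- `L` is described by some GF(2)-grammar over the alphabet `T`. -/
def IsDescribedByGF2Grammar {T : Type} (L : Language T) : Prop :=
  ∃ G : GF2Grammar T, G.language = L

/-! ### Subsets of `a^* b^*` and power series in two variables over the two-element field -/

/-- The alphabet `{a, b}`; its letters also serve as the two variables of power series. -/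
inductive Letter
  | a
  | b
deriving DecidableEq

/-- The word `a^n b^m` for the exponent vector `(n, m)`. -/
def abWord (e : Letter →₀ ℕ) : List Letter :=
  List.replicate (e .a) .a ++ List.replicate (e .b) .b

theorem abWord_injective : Function.Injective abWord := by
  intro e e' h
  have ha := congrArg (List.count Letter.a) h
  have hb := congrArg (List.count Letter.b) h
  simp [abWord, List.count_replicate] at ha hb
  ext x
  cases x
  · exact ha
  · exact hb

/-- The language `a^* b^*`. -/
def aStarBStar : Language Letter :=
  {w | ∃ n m : ℕ, w = List.replicate n .a ++ List.replicate m .b}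

theorem abWord_mem (e : Letter →₀ ℕ) : abWord e ∈ aStarBStar := ⟨e .a, e .b, rfl⟩

theorem exists_abWord {w : List Letter} (hw : w ∈ aStarBStar) : ∃ e, abWord e = w := by
  obtain ⟨n, m, rfl⟩ := hw
  refine ⟨Finsupp.single .a n + Finsupp.single .b m, ?_⟩
  simp [abWord]

open Classical in
/-- The correspondence between the subsets `{a^n b^m | (n, m) ∈ S}` of `a^* b^*` and the power
series `∑_{(n, m) ∈ S} a^n b^m` over the field with two elements. -/
def Dual : {L : Language Letter // L ≤ aStarBStar} ≃ MvPowerSeries Letter (ZMod 2) where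
  toFun L := fun e => if abWord e ∈ L.1 then 1 else 0
  invFun f := ⟨{w | ∃ e, abWord e = w ∧ MvPowerSeries.coeff e f = 1}, by
    rintro _ ⟨e, rfl, -⟩
    exact abWord_mem e⟩
  left_inv L := by
    apply Subtype.ext
    ext w
    constructor
    · rintro ⟨e, rfl, he⟩
      by_contra hn
      have h0 : (if abWord e ∈ L.1 then (1 : ZMod 2) else 0) = 1 := he
      rw [if_neg hn] at h0
      exact absurd h0 (by decide)
    · intro hw
      obtain ⟨e, rfl⟩ := exists_abWord (L.2 hw)
      exact ⟨e, rfl, if_pos hw⟩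
  right_inv f := by
    funext e
    have key : (∃ e', abWord e' = abWord e ∧ MvPowerSeries.coeff e' f = 1) ↔ f e = 1 := by
      constructor
      · rintro ⟨e', h, h1⟩
        rw [abWord_injective h] at h1
        exact h1
      · intro h
        exact ⟨e, rfl, h⟩
    change (if (∃ e', abWord e' = abWord e ∧ MvPowerSeries.coeff e' f = 1) then (1 : ZMod 2)
      else 0) = f e
    simp only [key]
    generalize f e = c
    revert c
    decide

/-- Laurent series in `a` and `b`: fractions of formal power series. -/
abbrev ABLaurentSeries : Type := FractionRing (MvPowerSeries Letter (ZMod 2))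

/-- The algebraic power series in the single variable `x`, as a set of power series in `a` and
`b`: these are the series `g(x)`, where the one-variable power series `g` is a root of a nonzero
polynomial with coefficients in the ring of one-variable polynomials. -/
def algebraicSeries (x : Letter) : Set (MvPowerSeries Letter (ZMod 2)) :=
  {f | ∃ g : PowerSeries (ZMod 2), IsAlgebraic (Polynomial (ZMod 2)) g ∧
    f = PowerSeries.subst (MvPowerSeries.X x : MvPowerSeries Letter (ZMod 2)) g}

/-- The set `R_{a,b}^{int}` of the Laurent series `(∑_{i=1}^n A_i B_i) / p`, where `A_i` and `B_i`
are algebraic power series in `a` and in `b` respectively, and `p` is a polynomial in `a` and `b`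
with constant term `1`. -/
def Rint : Set ABLaurentSeries :=
  {f | ∃ (n : ℕ) (A B : Fin n → MvPowerSeries Letter (ZMod 2)) (p : MvPolynomial Letter (ZMod 2)),
    (∀ i, A i ∈ algebraicSeries .a) ∧ (∀ i, B i ∈ algebraicSeries .b) ∧
    MvPolynomial.constantCoeff p = 1 ∧
    f = algebraMap (MvPowerSeries Letter (ZMod 2)) ABLaurentSeries (∑ i, A i * B i) /
      algebraMap (MvPowerSeries Letter (ZMod 2)) ABLaurentSeries
        (p : MvPowerSeries Letter (ZMod 2))}

end

/-!
Over a finite field with `q` elements, an algebraic power series `f` lies in a finite set that is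
stable under the Cartier operators `∑ aₙ Xⁿ ↦ ∑ a_{qn+r} Xⁿ` (Christol's theorem). For `q = 2` every
member `f` of this set is therefore `u² + X v²` with members `u` and `v`, so the `Aᵢ` and `Bᵢ` are
part of a solution of a finite system of polynomial equations. Joining to it the equation
`g = ∑ Aᵢ Bᵢ + (1 - p) g` describes `g = (∑ Aᵢ Bᵢ) / p`. The monomials of this system can be ordered
so that all letters `a` precede all letters `b`; then the equations hold for the corresponding
languages as well, with concatenation in place of the product.

Reading the equations as the rules of a grammar, the numbers of parse trees modulo 2 are also a
solution of the system. Weights on the symbols, under which every rule replaces a nonterminal by a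
lighter string, imply both that the numbers of parse trees are finite and that the solution is
unique. Splitting off constant terms is what makes such weights possible.
-/

noncomputable section

/-! ### Systems of language equations -/

section Convolution

variable {T R : Type*}

/-- The total weight of a list of letters or symbols weighted by `ω`. -/
def totalWeight (ω : T → ℤ) (w : List T) : ℤ :=
  (w.map ω).sum

@[simp]
theorem totalWeight_nil (ω : T → ℤ) : totalWeight ω [] = 0 :=
  rfl

@[simp]
theorem totalWeight_cons (ω : T → ℤ) (t : T) (w : List T) :
    totalWeight ω (t :: w) = ω t + totalWeight ω w :=
  List.sum_cons

@[simp]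
theorem totalWeight_append (ω : T → ℤ) (v w : List T) :
    totalWeight ω (v ++ w) = totalWeight ω v + totalWeight ω w := by
  simp [totalWeight]

/-- The weighted language `f` vanishes on all words of weight greater than `k`. -/
def SupportedOnWeightLE [Zero R] (ω : T → ℤ) (k : ℤ) (f : List T → R) : Prop :=
  ∀ w, f w ≠ 0 → totalWeight ω w ≤ k

theorem SupportedOnWeightLE.single [Zero R] [DecidableEq (List T)] (ω : T → ℤ) (w : List T)
    (r : R) : SupportedOnWeightLE ω (totalWeight ω w) (Pi.single w r) := by
  intro v hv
  obtain rfl : v = w := not_imp_comm.1 (fun h => Pi.single_eq_of_ne h (M := fun _ => R) r) hv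
  rfl

theorem finite_setOf_append_eq (w : List T) : {p : List T × List T | p.1 ++ p.2 = w}.Finite := by
  refine ((Set.finite_Iic w.length).image fun k => (w.take k, w.drop k)).subset ?_
  rintro ⟨u, v⟩ rfl
  exact ⟨u.length, by simp, by simp⟩

/-- The ways of splitting a word into a prefix and a suffix. -/
def wordAntidiagonal (w : List T) : Finset (List T × List T) :=
  (finite_setOf_append_eq w).toFinset

@[simp]
theorem mem_wordAntidiagonal {w : List T} {p : List T × List T} :
    p ∈ wordAntidiagonal w ↔ p.1 ++ p.2 = w := by
  simp [wordAntidiagonal]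

variable [Semiring R]

/-- The concatenation product of weighted languages. -/
def wordConv (f g : List T → R) (w : List T) : R :=
  ∑ p ∈ wordAntidiagonal w, f p.1 * g p.2

variable {ω : T → ℤ} {k l m : ℤ} {f f' g g' : List T → R}

theorem SupportedOnWeightLE.wordConv (hf : SupportedOnWeightLE ω k f)
    (hg : SupportedOnWeightLE ω l g) : SupportedOnWeightLE ω (k + l) (wordConv f g) := by
  intro w hw
  obtain ⟨p, hp, hne⟩ := Finset.exists_ne_zero_of_sum_ne_zero hw
  rw [← mem_wordAntidiagonal.1 hp, totalWeight_append]
  exact add_le_add (hf _ (left_ne_zero_of_mul hne)) (hg _ (right_ne_zero_of_mul hne))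

theorem wordConv_congr (hf : SupportedOnWeightLE ω k f) (hf' : SupportedOnWeightLE ω k f')
    (hg : SupportedOnWeightLE ω l g) (hg' : SupportedOnWeightLE ω l g')
    (hff' : ∀ w, k - totalWeight ω w < m → f w = f' w)
    (hgg' : ∀ w, l - totalWeight ω w < m → g w = g' w) {w : List T}
    (hw : k + l - totalWeight ω w < m) : wordConv f g w = wordConv f' g' w := by
  refine Finset.sum_congr rfl fun p hp => ?_
  rw [← mem_wordAntidiagonal.1 hp, totalWeight_append] at hw
  by_cases hk : totalWeight ω p.1 ≤ k
  · by_cases hl : totalWeight ω p.2 ≤ l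
    · rw [hff' _ (by lia), hgg' _ (by lia)]
    · rw [not_imp_comm.1 (hg _) hl, not_imp_comm.1 (hg' _) hl, mul_zero, mul_zero]
  · rw [not_imp_comm.1 (hf _) hk, not_imp_comm.1 (hf' _) hk, zero_mul, zero_mul]

end Convolution

section StringLanguage

variable {T N R : Type*} [Semiring R]

open Classical in
/-- The weighted language of a symbol, given those of the nonterminals. -/
def symbolLanguage (F : N → List T → R) : Symbol T N → List T → R
  | .terminal t => Pi.single [t] 1
  | .nonterminal A => F A

open Classical in
/-- The weighted language of a string of symbols, given those of the nonterminals. -/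
def stringLanguage (F : N → List T → R) : List (Symbol T N) → List T → R
  | [] => Pi.single [] 1
  | X :: α => wordConv (symbolLanguage F X) (stringLanguage F α)

variable {ω : Symbol T N → ℤ} {F F' : N → List T → R}

/-- The weighted language assigned to each nonterminal vanishes on the words which weigh more than
that nonterminal. -/
def IsWeightBounded (ω : Symbol T N → ℤ) (F : N → List T → R) : Prop :=
  ∀ A, SupportedOnWeightLE (ω ∘ .terminal) (ω (.nonterminal A)) (F A)

theorem IsWeightBounded.symbolLanguage (hF : IsWeightBounded ω F) (X : Symbol T N) :
    SupportedOnWeightLE (ω ∘ .terminal) (ω X) (symbolLanguage F X) := by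
  classical
  cases X with
  | terminal t =>
    have h := SupportedOnWeightLE.single (ω ∘ .terminal) [t] (1 : R)
    rwa [totalWeight_cons, totalWeight_nil, add_zero] at h
  | nonterminal A => exact hF A

theorem IsWeightBounded.stringLanguage (hF : IsWeightBounded ω F) (α : List (Symbol T N)) :
    SupportedOnWeightLE (ω ∘ .terminal) (totalWeight ω α) (stringLanguage F α) := by
  classical
  induction α with
  | nil => exact SupportedOnWeightLE.single _ [] _
  | cons X α ih => exact (hF.symbolLanguage X).wordConv ih

theorem stringLanguage_congr {m : ℤ} (hF : IsWeightBounded ω F) (hF' : IsWeightBounded ω F')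
    (h : ∀ A w, ω (.nonterminal A) - totalWeight (ω ∘ .terminal) w < m → F A w = F' A w)
    {α : List (Symbol T N)} {w : List T}
    (hw : totalWeight ω α - totalWeight (ω ∘ .terminal) w < m) :
    stringLanguage F α w = stringLanguage F' α w := by
  induction α generalizing w with
  | nil => rfl
  | cons X α ih =>
    refine wordConv_congr (hF.symbolLanguage X) (hF'.symbolLanguage X) (hF.stringLanguage α)
      (hF'.stringLanguage α) (fun v hv => ?_) (fun v hv => ih hv) hw
    cases X with
    | terminal t => rfl
    | nonterminal A => exact h A v hv

-- The contributions to `F A w` come from pairs with a smaller value of `ω A - ω w`.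
theorem eq_of_solutions (rhs : N → List (Symbol T N) →₀ R)
    (hrhs : ∀ A, ∀ α ∈ (rhs A).support, totalWeight ω α < ω (.nonterminal A))
    (hF : IsWeightBounded ω F) (hF' : IsWeightBounded ω F')
    (h : ∀ A, F A = Finsupp.linearCombination R (stringLanguage F) (rhs A))
    (h' : ∀ A, F' A = Finsupp.linearCombination R (stringLanguage F') (rhs A)) : F = F' := by
  suffices ∀ (n : ℕ) A w, ω (.nonterminal A) - totalWeight (ω ∘ .terminal) w < n →
      F A w = F' A w by
    funext A w
    exact this (ω (.nonterminal A) - totalWeight (ω ∘ .terminal) w + 1).toNat A w (by lia)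
  intro n
  induction n with
  | zero =>
    intro A w hw
    have hlt : ¬ totalWeight (ω ∘ .terminal) w ≤ ω (.nonterminal A) := by simpa using hw
    rw [not_imp_comm.1 (hF A w) hlt, not_imp_comm.1 (hF' A w) hlt]
  | succ n ih =>
    intro A w hw
    simp only [h A, h' A, Finsupp.linearCombination_apply, Finsupp.sum, Finset.sum_apply,
      Pi.smul_apply]
    refine Finset.sum_congr rfl fun α hα => ?_
    have := hrhs A α hα
    rw [stringLanguage_congr hF hF' ih (by lia)]

end StringLanguage

/-! ### Counting parse trees -/

section ParseTrees

variable {T : Type} {G : ContextFreeGrammar T}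

/-- The parse trees of the word `w` as the symbol `X`. -/
def SymbolTreesOf (G : ContextFreeGrammar T) (X : Symbol T G.NT) (w : List T) : Type :=
  {t : ParseTree G X // t.yield = w}

/-- The sequences of parse trees of the word `w` as the string `α`. -/
def ForestsOf (G : ContextFreeGrammar T) (α : List (Symbol T G.NT)) (w : List T) : Type :=
  {ts : ParseForest G α // ts.yield = w}

/-- The strings that rules of `G` allow as replacements of the nonterminal `A`. -/
def ruleOutputs (G : ContextFreeGrammar T) (A : G.NT) : Finset (List (Symbol T G.NT)) :=
  G.rules.preimage (ContextFreeRule.mk A) fun _ _ _ _ h => (ContextFreeRule.mk.inj h).2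

@[simp]
theorem mem_ruleOutputs {A : G.NT} {α : List (Symbol T G.NT)} :
    α ∈ ruleOutputs G A ↔ ContextFreeRule.mk A α ∈ G.rules :=
  Finset.mem_preimage

instance (t : T) : Unique (ParseTree G (.terminal t)) where
  default := .leaf t
  uniq := by rintro ⟨⟩; rfl

instance : Unique (ParseForest G []) where
  default := .nil
  uniq := by rintro ⟨⟩; rfl

/-- A sequence of parse trees splits into its first tree and the others. -/
def forestsOfConsEquiv (X : Symbol T G.NT) (α : List (Symbol T G.NT)) (w : List T) :
    ForestsOf G (X :: α) w ≃
      Σ p : wordAntidiagonal w, SymbolTreesOf G X p.1.1 × ForestsOf G α p.1.2 where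
  toFun
    | ⟨.cons _ _ t ts, h⟩ => ⟨⟨(t.yield, ts.yield), mem_wordAntidiagonal.2 h⟩, ⟨t, rfl⟩, ⟨ts, rfl⟩⟩
  invFun s := ⟨.cons X α s.2.1.1 s.2.2.1, by
    obtain ⟨⟨p, hp⟩, ⟨t, ht⟩, ⟨ts, hts⟩⟩ := s
    simpa [ParseForest.yield, ht, hts] using hp⟩
  left_inv := by
    rintro ⟨⟨⟩, h⟩
    rfl
  right_inv := by
    rintro ⟨⟨⟨u, v⟩, hp⟩, ⟨t, ht⟩, ⟨ts, hts⟩⟩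
    dsimp only at ht hts
    subst ht hts
    rfl

/-- A parse tree splits into the rule used at the root and the subtrees. -/
def parseTreesOfEquiv (A : G.NT) (w : List T) :
    ParseTreesOf G A w ≃ Σ α : ruleOutputs G A, ForestsOf G α w where
  toFun
    | ⟨.node _ α h ts, hw⟩ => ⟨⟨α, mem_ruleOutputs.2 h⟩, ⟨ts, hw⟩⟩
  invFun s := ⟨.node A s.1.1 (mem_ruleOutputs.1 s.1.2) s.2.1, s.2.2⟩
  left_inv := by
    rintro ⟨⟨⟩, h⟩
    rfl
  right_inv := by
    rintro ⟨⟨α, h⟩, ⟨ts, hts⟩⟩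
    rfl

theorem finite_forestsOf_cons {X : Symbol T G.NT} {α : List (Symbol T G.NT)} {w : List T}
    (h : ∀ u v, u ++ v = w → Finite (SymbolTreesOf G X u × ForestsOf G α v)) :
    Finite (ForestsOf G (X :: α) w) :=
  have (p : wordAntidiagonal w) : Finite (SymbolTreesOf G X p.1.1 × ForestsOf G α p.1.2) :=
    h _ _ (mem_wordAntidiagonal.1 p.2)
  .of_equiv _ (forestsOfConsEquiv X α w).symm

section Counting

variable {R : Type*} [Semiring R]

theorem natCast_card_fiber_of_unique {α β : Type*} [Unique α] [DecidableEq β] (f : α → β)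
    (b : β) :
    (Nat.card {a // f a = b} : R) = (Pi.single (f default) 1 : β → R) b := by
  rcases eq_or_ne b (f default) with rfl | hb
  · have : Nonempty {a // f a = f default} := ⟨default, rfl⟩
    rw [Pi.single_eq_same, Nat.card_of_subsingleton this.some, Nat.cast_one]
  · have : IsEmpty {a // f a = b} := ⟨fun a => hb (a.2 ▸ congrArg f (Unique.eq_default _))⟩
    rw [Pi.single_eq_of_ne hb, Nat.card_of_isEmpty, Nat.cast_zero]

variable (G R) in
/-- The numbers of parse trees, as elements of `R`. -/
def treeCount (A : G.NT) (w : List T) : R :=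
  Nat.card (ParseTreesOf G A w)

theorem natCast_card_symbolTreesOf (X : Symbol T G.NT) (w : List T) :
    (Nat.card (SymbolTreesOf G X w) : R) = symbolLanguage (treeCount G R) X w := by
  classical
  cases X with
  | terminal t =>
    exact natCast_card_fiber_of_unique (α := ParseTree G (.terminal t)) ParseTree.yield w
  | nonterminal A => rfl

variable [hfin : ∀ A w, Finite (ParseTreesOf G A w)]

instance (X : Symbol T G.NT) (w : List T) : Finite (SymbolTreesOf G X w) :=
  match X with
  | .terminal _ => inferInstanceAs (Finite (Subtype _))
  | .nonterminal A => hfin A w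

instance (α : List (Symbol T G.NT)) (w : List T) : Finite (ForestsOf G α w) := by
  induction α generalizing w with
  | nil => exact inferInstanceAs (Finite (Subtype _))
  | cons X α ih => exact finite_forestsOf_cons fun u v _ => inferInstance

theorem natCast_card_forestsOf (α : List (Symbol T G.NT)) (w : List T) :
    (Nat.card (ForestsOf G α w) : R) = stringLanguage (treeCount G R) α w := by
  classical
  induction α generalizing w with
  | nil => exact natCast_card_fiber_of_unique (α := ParseForest G []) ParseForest.yield w
  | cons X α ih =>
    rw [Nat.card_congr (forestsOfConsEquiv X α w), Nat.card_sigma, Nat.cast_sum,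
      stringLanguage, wordConv]
    refine .trans (Finset.sum_congr rfl fun p _ => ?_) (Finset.sum_coe_sort (wordAntidiagonal w) _)
    rw [Nat.card_prod, Nat.cast_mul, ih, natCast_card_symbolTreesOf]

theorem treeCount_eq_sum_ruleOutputs (A : G.NT) :
    treeCount G R A = ∑ α ∈ ruleOutputs G A, stringLanguage (treeCount G R) α := by
  funext w
  rw [treeCount, Nat.card_congr (parseTreesOfEquiv A w), Nat.card_sigma, Nat.cast_sum,
    Finset.sum_apply]
  exact (Finset.sum_congr rfl fun α _ => natCast_card_forestsOf α.1 w).trans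
    (Finset.sum_coe_sort (ruleOutputs G A) fun α => stringLanguage (treeCount G R) α w)

end Counting

section Weights

variable {ω : Symbol T G.NT → ℤ}

/-- Every rule replaces a nonterminal with a string of smaller weight. -/
def IsDecreasing (G : ContextFreeGrammar T) (ω : Symbol T G.NT → ℤ) : Prop :=
  ∀ A, ∀ α ∈ ruleOutputs G A, totalWeight ω α < ω (.nonterminal A)

mutual

theorem ParseTree.totalWeight_yield_le (hG : IsDecreasing G ω) {X : Symbol T G.NT} :
    ∀ t : ParseTree G X, totalWeight (ω ∘ .terminal) t.yield ≤ ω X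
  | .leaf _ => by simp [ParseTree.yield]
  | .node A α h ts =>
    (ts.totalWeight_yield_le hG).trans (hG A α (mem_ruleOutputs.2 h)).le

theorem ParseForest.totalWeight_yield_le (hG : IsDecreasing G ω) {α : List (Symbol T G.NT)} :
    ∀ ts : ParseForest G α, totalWeight (ω ∘ .terminal) ts.yield ≤ totalWeight ω α
  | .nil => le_rfl
  | .cons X α t ts => by
    rw [ParseForest.yield, totalWeight_append, totalWeight_cons]
    exact add_le_add (t.totalWeight_yield_le hG) (ts.totalWeight_yield_le hG)

end

theorem IsDecreasing.finite_forestsOf (hG : IsDecreasing G ω) {m : ℤ}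
    (h : ∀ A w, ω (.nonterminal A) - totalWeight (ω ∘ .terminal) w < m →
      Finite (ParseTreesOf G A w)) {α : List (Symbol T G.NT)} {w : List T}
    (hw : totalWeight ω α - totalWeight (ω ∘ .terminal) w < m) : Finite (ForestsOf G α w) := by
  induction α generalizing w with
  | nil => exact inferInstanceAs (Finite (Subtype _))
  | cons X α ih =>
    refine finite_forestsOf_cons ?_
    rintro u v rfl
    rw [totalWeight_cons, totalWeight_append] at hw
    rcases isEmpty_or_nonempty (SymbolTreesOf G X u) with _ | ⟨t, rfl⟩
    · infer_instance
    rcases isEmpty_or_nonempty (ForestsOf G α v) with _ | ⟨ts, rfl⟩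
    · infer_instance
    have ht := t.totalWeight_yield_le hG
    have hts := ts.totalWeight_yield_le hG
    have : Finite (SymbolTreesOf G X t.yield) := by
      cases X with
      | terminal _ => exact inferInstanceAs (Finite (Subtype _))
      | nonterminal A => exact h A _ (by lia)
    have := ih (w := ts.yield) (by lia)
    infer_instance

theorem IsDecreasing.finite_parseTreesOf (hG : IsDecreasing G ω) (A : G.NT) (w : List T) :
    Finite (ParseTreesOf G A w) := by
  suffices ∀ (n : ℕ) A w, ω (.nonterminal A) - totalWeight (ω ∘ .terminal) w < n →
      Finite (ParseTreesOf G A w) from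
    this (ω (.nonterminal A) - totalWeight (ω ∘ .terminal) w + 1).toNat A w (by lia)
  intro n
  induction n with
  | zero =>
    intro A w hw
    have : IsEmpty (ParseTreesOf G A w) := by
      refine ⟨?_⟩
      rintro ⟨t, rfl⟩
      have := t.totalWeight_yield_le hG
      lia
    infer_instance
  | succ n ih =>
    intro A w hw
    have (α : ruleOutputs G A) : Finite (ForestsOf G α w) := by
      have := hG A α α.2
      exact hG.finite_forestsOf ih (by lia)
    exact .of_equiv _ (parseTreesOfEquiv A w).symm

theorem IsDecreasing.isWeightBounded_treeCount (hG : IsDecreasing G ω) (R : Type*) [Semiring R] :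
    IsWeightBounded ω (treeCount G R) := by
  intro A w hw
  have hcard : Nat.card (ParseTreesOf G A w) ≠ 0 := fun h => hw (by simp [treeCount, h])
  obtain ⟨t, rfl⟩ := (Nat.card_ne_zero.1 hcard).1
  exact t.totalWeight_yield_le hG

end Weights

end ParseTrees

section Systems

variable {T N : Type}

open Classical in
/-- The grammar whose rules are the pairs `A → α` with `α` in the support of the right-hand side
for `A`. -/
abbrev systemGrammar [Fintype N] (S : N) (rhs : N → List (Symbol T N) →₀ ZMod 2) :
    ContextFreeGrammar T :=
  ⟨N, S, Finset.univ.biUnion fun A => (rhs A).support.image (.mk A)⟩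

theorem ruleOutputs_systemGrammar [Fintype N] (S : N) (rhs : N → List (Symbol T N) →₀ ZMod 2)
    (A : N) :
    ruleOutputs (systemGrammar S rhs) A = (rhs A).support := by
  ext α
  exact mem_ruleOutputs.trans (by simp)

theorem linearCombination_zmod_two {ι M : Type*} [AddCommGroup M] [Module (ZMod 2) M] (v : ι → M)
    (c : ι →₀ ZMod 2) : Finsupp.linearCombination (ZMod 2) v c = ∑ i ∈ c.support, v i := by
  refine Finset.sum_congr rfl fun i hi => ?_
  have hi : c i = 1 := Fin.eq_one_of_ne_zero _ (Finsupp.mem_support_iff.1 hi)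
  simp [hi]

theorem isDescribedByGF2Grammar_of_solution [Finite N] {ω : Symbol T N → ℤ} (S : N)
    (rhs : N → List (Symbol T N) →₀ ZMod 2)
    (hrhs : ∀ A, ∀ α ∈ (rhs A).support, totalWeight ω α < ω (.nonterminal A))
    {F : N → List T → ZMod 2} (hbdd : IsWeightBounded ω F)
    (hF : ∀ A, F A = Finsupp.linearCombination (ZMod 2) (stringLanguage F) (rhs A)) :
    IsDescribedByGF2Grammar ({w | F S w = 1} : Language T) := by
  have := Fintype.ofFinite N
  have hG : IsDecreasing (systemGrammar S rhs) ω := fun A α hα =>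
    hrhs A α (by rwa [ruleOutputs_systemGrammar] at hα)
  have hfin := hG.finite_parseTreesOf
  have hcount : treeCount (systemGrammar S rhs) (ZMod 2) = F :=
    eq_of_solutions rhs hrhs (hG.isWeightBounded_treeCount _) hbdd (fun A => by
      rw [treeCount_eq_sum_ruleOutputs, linearCombination_zmod_two, ruleOutputs_systemGrammar]) hF
  refine ⟨⟨systemGrammar S rhs, inferInstanceAs (Finite N), hfin⟩, Set.ext fun w => ?_⟩
  rw [← hcount]
  exact ZMod.natCast_eq_one_iff_odd.symm

end Systems

/-! ### Algebraic power series over a finite field -/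

section Christol

open scoped PowerSeries Polynomial

variable {R : Type*}

/-- The operator `∑ aₙ Xⁿ ↦ ∑ a_{qn+r} Xⁿ` (for `r < q`, the Cartier operator `Λ_r`). -/
def cartier [Semiring R] (q r : ℕ) : R⟦X⟧ →ₗ[R] R⟦X⟧ where
  toFun f := .mk fun n => f.coeff (q * n + r)
  map_add' f g := by ext; simp
  map_smul' c f := by ext; simp

@[simp]
theorem coeff_cartier [Semiring R] (q r n : ℕ) (f : R⟦X⟧) :
    (cartier q r f).coeff n = f.coeff (q * n + r) := by
  simp [cartier]

theorem cartier_expand_mul [CommRing R] {q r : ℕ} (hq : q ≠ 0) (hr : r < q) (g f : R⟦X⟧) :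
    cartier q r (g.expand q hq * f) = g * cartier q r f := by
  ext n
  rw [coeff_cartier, PowerSeries.coeff_mul, PowerSeries.coeff_mul]
  symm
  refine Finset.sum_of_injOn (fun d => (q * d.1, q * d.2 + r)) ?_ ?_ ?_ ?_
  · rintro ⟨i, j⟩ - ⟨i', j'⟩ - h
    simpa [hq] using h
  · rintro ⟨i, j⟩ h
    simp only [Finset.mem_coe, Finset.HasAntidiagonal.mem_antidiagonal] at h ⊢
    rw [← h, mul_add, add_assoc]
  · rintro ⟨i, j⟩ h hij
    rw [Finset.HasAntidiagonal.mem_antidiagonal] at h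
    rw [PowerSeries.coeff_expand, if_neg, zero_mul]
    rintro ⟨i, rfl⟩
    have hi : i ≤ n := by
      by_contra! hn
      nlinarith
    refine hij ⟨(i, n - i), by simp [hi], Prod.ext rfl ?_⟩
    simp only [Nat.mul_sub]
    have := Nat.mul_le_mul_left q hi
    omega
  · rintro ⟨i, j⟩ -
    simp

theorem exists_cartier_ne_zero [Semiring R] {q : ℕ} (hq : 0 < q) {f : R⟦X⟧} (hf : f ≠ 0) :
    ∃ r < q, cartier q r f ≠ 0 := by
  obtain ⟨n, hn⟩ := PowerSeries.exists_coeff_ne_zero_iff_ne_zero.2 hf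
  refine ⟨n % q, n.mod_lt hq, fun h => hn ?_⟩
  rw [← Nat.div_add_mod n q, ← coeff_cartier, h, map_zero]

theorem eq_sum_X_pow_mul_expand_cartier [CommRing R] {q : ℕ} (hq : q ≠ 0) (f : R⟦X⟧) :
    f = ∑ r ∈ Finset.range q, PowerSeries.X ^ r * (cartier q r f).expand q hq := by
  ext n
  have hmod : n % q < q := n.mod_lt (by lia)
  rw [map_sum, Finset.sum_eq_single_of_mem _ (Finset.mem_range.2 hmod)]
  · rw [PowerSeries.coeff_X_pow_mul', if_pos (n.mod_le q), PowerSeries.coeff_expand,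
      if_pos (Nat.dvd_sub_mod n), coeff_cartier, Nat.mul_div_cancel' (Nat.dvd_sub_mod n),
      Nat.sub_add_cancel (n.mod_le q)]
  · intro r hr hne
    rw [Finset.mem_range] at hr
    rw [PowerSeries.coeff_X_pow_mul']
    split_ifs with hle
    · rw [PowerSeries.coeff_expand, if_neg fun h => hne ?_]
      rw [← Nat.mod_eq_of_lt hr, ← (Nat.modEq_iff_dvd' hle).2 h, Nat.mod_eq_of_lt hr]
    · rfl

theorem polynomial_smul_eq_coe_mul [CommSemiring R] (p : R[X]) (f : R⟦X⟧) :
    p • f = (p : R⟦X⟧) * f :=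
  rfl

theorem exists_polynomial_coe_eq_cartier [Semiring R] {q m : ℕ} (hq : 0 < q) (r : ℕ) {c : R[X]}
    (hc : c.natDegree ≤ q * m) : ∃ u : R[X], u.natDegree ≤ m ∧ (u : R⟦X⟧) = cartier q r c := by
  refine ⟨(cartier q r (c : R⟦X⟧)).trunc (m + 1),
    Nat.le_of_lt_succ (PowerSeries.natDegree_trunc_lt _ m), ?_⟩
  ext n
  rw [Polynomial.coeff_coe, PowerSeries.coeff_trunc]
  split_ifs with hn
  · rfl
  · rw [coeff_cartier, Polynomial.coeff_coe, Polynomial.coeff_eq_zero_of_natDegree_lt]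
    nlinarith

theorem exists_not_linearIndependent_pow_of_isAlgebraic {A : Type*} [CommRing R] [IsDomain R]
    [CommRing A] [Algebra R A] {y : A} (hy : IsAlgebraic R y) :
    ∃ k, ∀ e : Fin (k + 1) → ℕ, ¬ LinearIndependent R fun i => y ^ e i := by
  obtain ⟨a, ha, hint⟩ := hy.exists_integral_multiple
  let B := Algebra.adjoin R {a • y}
  have : Module.Finite R B := Module.Finite.iff_fg.2 hint.fg_adjoin_singleton
  refine ⟨Module.finrank R B, fun e he => ?_⟩
  let z : B := ⟨a • y, Algebra.subset_adjoin rfl⟩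
  have hz : LinearIndependent R fun i => z ^ e i := by
    refine .of_comp B.val.toLinearMap (Fintype.linearIndependent_iff.2 fun c hc i => ?_)
    have h := Fintype.linearIndependent_iff.1 he (fun i => c i * a ^ e i)
      (by simpa [z, smul_pow, mul_smul] using hc) i
    exact (mul_eq_zero.1 h).resolve_right (pow_ne_zero _ ha)
  simpa using hz.fintype_card_le_finrank

variable {K : Type*} [Field K] [Fintype K]

theorem expand_card_eq_pow (f : K⟦X⟧) :
    f.expand (Fintype.card K) Fintype.card_ne_zero = f ^ Fintype.card K := by
  obtain ⟨p, _⟩ := CharP.exists K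
  obtain ⟨n, hp, hK⟩ := FiniteField.card K p
  have := Fact.mk hp
  have hfrob : iterateFrobenius K p n = RingHom.id K := by
    ext x
    rw [iterateFrobenius_def, ← hK, FiniteField.pow_card, RingHom.id_apply]
  have h := MvPowerSeries.map_iterateFrobenius_expand p hp.ne_zero f n
  simp only [hfrob, MvPowerSeries.map_id, RingHom.id_apply, ← hK] at h
  rw [← h]
  rfl

theorem eq_sum_X_pow_mul_cartier_pow (f : K⟦X⟧) :
    f = ∑ r ∈ Finset.range (Fintype.card K),
      PowerSeries.X ^ r * cartier (Fintype.card K) r f ^ Fintype.card K := by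
  simpa only [expand_card_eq_pow] using
    eq_sum_X_pow_mul_expand_cartier (Fintype.card_ne_zero (α := K)) f

theorem cartier_sum_smul_pow {ι : Type*} [Fintype ι] {r : ℕ} (hr : r < Fintype.card K)
    {c u : ι → K[X]} (hu : ∀ i, (u i : K⟦X⟧) = cartier (Fintype.card K) r (c i)) (f : ι → K⟦X⟧) :
    cartier (Fintype.card K) r (∑ i, c i • f i ^ Fintype.card K) = ∑ i, u i • f i := by
  rw [map_sum]
  refine Finset.sum_congr rfl fun i _ => ?_
  rw [← expand_card_eq_pow, polynomial_smul_eq_coe_mul, mul_comm, cartier_expand_mul _ hr, ← hu,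
    mul_comm, polynomial_smul_eq_coe_mul]

theorem exists_frobenius_relation_head_ne_zero {f : K⟦X⟧} {k : ℕ} (c : Fin k → K[X]) (hc : c ≠ 0)
    (h : ∑ i, c i • f ^ Fintype.card K ^ (i : ℕ) = 0) :
    ∃ (l : ℕ) (d : Fin (l + 1) → K[X]),
      d 0 ≠ 0 ∧ ∑ i, d i • f ^ Fintype.card K ^ (i : ℕ) = 0 := by
  induction k with
  | zero => exact absurd (Subsingleton.elim _ _) hc
  | succ k ih =>
    by_cases h₀ : c 0 = 0
    · obtain ⟨j, hj⟩ : ∃ j : Fin k, c j.succ ≠ 0 := by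
        by_contra! hsucc
        exact hc (funext (Fin.cases h₀ hsucc))
      obtain ⟨r, hr, hne⟩ := exists_cartier_ne_zero (Fintype.card_pos (α := K))
        ((Polynomial.coe_eq_zero_iff (R := K)).not.2 hj)
      choose u _ hu using fun i : Fin k => exists_polynomial_coe_eq_cartier
        (Fintype.card_pos (α := K)) r
        (Nat.le_mul_of_pos_left (c i.succ).natDegree (Fintype.card_pos (α := K)))
      refine ih u (fun h => hne (by simp [← hu, h])) ?_
      simp only [Fin.sum_univ_succ, h₀, zero_smul, zero_add, Fin.val_succ, pow_succ, pow_mul] at h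
      rw [← cartier_sum_smul_pow hr hu, h, map_zero]
    · exact ⟨k, c, h₀, h⟩

theorem exists_frobenius_relation_of_isAlgebraic {f : K⟦X⟧} (hf : IsAlgebraic K[X] f) :
    ∃ (k : ℕ) (c : Fin (k + 1) → K[X]),
      c 0 ≠ 0 ∧ ∑ i, c i • f ^ Fintype.card K ^ (i : ℕ) = 0 := by
  obtain ⟨k, hk⟩ := exists_not_linearIndependent_pow_of_isAlgebraic hf
  obtain ⟨c, hc, i, hi⟩ := Fintype.not_linearIndependent_iff.1 (hk fun i => Fintype.card K ^ i.val)
  exact exists_frobenius_relation_head_ne_zero c (fun h => hi (congrFun h i)) hc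

/-- The combinations of `f, f ^ q, …, f ^ q ^ k`, where `q` is the order of the field `K`, with
polynomial coefficients of degree at most `M`. -/
def frobeniusSpan (f : K⟦X⟧) (k M : ℕ) : Set K⟦X⟧ :=
  {h | ∃ d : Fin (k + 1) → K[X],
    (∀ i, (d i).natDegree ≤ M) ∧ h = ∑ i, d i • f ^ Fintype.card K ^ (i : ℕ)}

theorem finite_setOf_natDegree_le (R : Type*) [Semiring R] [Finite R] (n : ℕ) :
    {p : R[X] | p.natDegree ≤ n}.Finite := by
  have : Finite (Polynomial.degreeLT R (n + 1)) :=
    .of_equiv _ (Polynomial.degreeLTEquiv R (n + 1)).symm.toEquiv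
  refine (Polynomial.degreeLT R (n + 1) : Set R[X]).toFinite.subset fun p hp => ?_
  exact Polynomial.mem_degreeLT.2
    ((Polynomial.natDegree_le_iff_degree_le.1 hp).trans_lt (by exact_mod_cast n.lt_succ_self))

theorem finite_frobeniusSpan (f : K⟦X⟧) (k M : ℕ) : (frobeniusSpan f k M).Finite := by
  refine ((Set.Finite.pi' fun _ : Fin (k + 1) => finite_setOf_natDegree_le K M).image
    fun d : Fin (k + 1) → K[X] => ∑ i, d i • f ^ Fintype.card K ^ (i : ℕ)).subset ?_
  rintro _ ⟨d, hd, rfl⟩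
  exact ⟨d, hd, rfl⟩

-- Eliminating `f` between the relation and the expansion of `c 0 • h` leaves only `q`-th powers.
theorem exists_pow_card_smul_eq_sum_pow_card {f h : K⟦X⟧} {k M : ℕ} {c : Fin (k + 1) → K[X]}
    (hc : ∑ i, c i • f ^ Fintype.card K ^ (i : ℕ) = 0) (hM : ∀ i, (c i).natDegree ≤ M)
    (hh : c 0 • h ∈ frobeniusSpan f k M) :
    ∃ e : Fin k → K[X], (∀ i, (e i).natDegree ≤ Fintype.card K * M) ∧
      c 0 ^ Fintype.card K • h =
        ∑ i, e i • (f ^ Fintype.card K ^ (i : ℕ)) ^ Fintype.card K := by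
  obtain ⟨d, hd, hsum⟩ := hh
  obtain ⟨m, hm⟩ := Nat.exists_eq_add_of_le' (Fintype.one_lt_card (α := K))
  let e (i : Fin (k + 1)) : K[X] := c 0 ^ m * (c 0 * d i - d 0 * c i)
  refine ⟨fun i => e i.succ, fun i => ?_, ?_⟩
  · have hle := Polynomial.natDegree_sub_le_of_le
      (Polynomial.natDegree_mul_le_of_le (hM 0) (hd i.succ))
      (Polynomial.natDegree_mul_le_of_le (hd 0) (hM i.succ))
    calc (e i.succ).natDegree ≤ m * M + max (M + M) (M + M) :=
          Polynomial.natDegree_mul_le_of_le (Polynomial.natDegree_pow_le_of_le m (hM 0)) hle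
      _ = Fintype.card K * M := by rw [max_self, hm]; ring
  · calc c 0 ^ Fintype.card K • h
        = c 0 ^ m • (c 0 • c 0 • h) := by
          rw [smul_smul, smul_smul, hm]
          ring_nf
      _ = c 0 ^ m • (c 0 • ∑ i, d i • f ^ Fintype.card K ^ (i : ℕ) -
            d 0 • ∑ i, c i • f ^ Fintype.card K ^ (i : ℕ)) := by
          rw [hsum, hc, smul_zero, sub_zero]
      _ = ∑ i, e i • f ^ Fintype.card K ^ (i : ℕ) := by
          simp only [e, Finset.smul_sum, ← Finset.sum_sub_distrib, smul_smul, ← sub_smul]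
      _ = ∑ i : Fin k, e i.succ • (f ^ Fintype.card K ^ (i : ℕ)) ^ Fintype.card K := by
          rw [Fin.sum_univ_succ]
          simp [e, mul_comm (d 0), pow_succ, pow_mul]

theorem smul_cartier_mem_frobeniusSpan {f h : K⟦X⟧} {k M r : ℕ} {c : Fin (k + 1) → K[X]}
    (hc : ∑ i, c i • f ^ Fintype.card K ^ (i : ℕ) = 0) (hM : ∀ i, (c i).natDegree ≤ M)
    (hr : r < Fintype.card K) (hh : c 0 • h ∈ frobeniusSpan f k M) :
    c 0 • cartier (Fintype.card K) r h ∈ frobeniusSpan f k M := by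
  obtain ⟨e, he, hpow⟩ := exists_pow_card_smul_eq_sum_pow_card hc hM hh
  choose u hu hcoe using fun i =>
    exists_polynomial_coe_eq_cartier (Fintype.card_pos (α := K)) r (he i)
  refine ⟨Fin.snoc u 0, Fin.lastCases (by simp) (by simpa using hu), ?_⟩
  calc c 0 • cartier (Fintype.card K) r h
      = cartier (Fintype.card K) r (c 0 ^ Fintype.card K • h) := by
        rw [polynomial_smul_eq_coe_mul, polynomial_smul_eq_coe_mul, Polynomial.coe_pow,
          ← expand_card_eq_pow, cartier_expand_mul _ hr]
    _ = ∑ i : Fin k, u i • f ^ Fintype.card K ^ (i : ℕ) := by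
        rw [hpow, cartier_sum_smul_pow hr hcoe]
    _ = _ := by simp [Fin.sum_univ_castSucc]

theorem exists_finite_mapsTo_cartier {f : K⟦X⟧} (hf : IsAlgebraic K[X] f) :
    ∃ V : Set K⟦X⟧, V.Finite ∧ f ∈ V ∧
      ∀ r < Fintype.card K, Set.MapsTo (cartier (Fintype.card K) r) V V := by
  obtain ⟨k, c, hc₀, hc⟩ := exists_frobenius_relation_of_isAlgebraic hf
  let M := Finset.univ.sup fun i => (c i).natDegree
  have hM (i) : (c i).natDegree ≤ M := Finset.le_sup (f := fun i => (c i).natDegree) (by simp)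
  have hinj : Function.Injective fun h : K⟦X⟧ => c 0 • h := by
    simpa only [polynomial_smul_eq_coe_mul] using
      mul_right_injective₀ ((Polynomial.coe_eq_zero_iff (R := K)).not.2 hc₀)
  refine ⟨(c 0 • ·) ⁻¹' frobeniusSpan f k M, (finite_frobeniusSpan f k M).preimage hinj.injOn,
    ⟨Pi.single 0 (c 0), fun i => ?_, ?_⟩, fun r hr h => smul_cartier_mem_frobeniusSpan hc hM hr⟩
  · rcases eq_or_ne i 0 with rfl | hi <;> simp [*]
  · rw [Fin.sum_univ_succ]
    simp

theorem exists_finite_mapsTo_cartier_of_finite {ι : Type*} [Finite ι] (f : ι → K⟦X⟧)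
    (hf : ∀ i, IsAlgebraic K[X] (f i)) :
    ∃ V : Set K⟦X⟧, V.Finite ∧ (∀ i, f i ∈ V) ∧
      ∀ r < Fintype.card K, Set.MapsTo (cartier (Fintype.card K) r) V V := by
  choose V hfin hmem hV using fun i => exists_finite_mapsTo_cartier (hf i)
  exact ⟨⋃ i, V i, Set.finite_iUnion hfin, fun i => Set.mem_iUnion_of_mem i (hmem i),
    fun r hr => Set.mapsTo_iUnion_iUnion fun i => hV i r hr⟩

end Christol

/-! ### Power series in two variables as weighted languages -/

section WordSeries

variable {R : Type*} [CommSemiring R]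

theorem abWord_single (x : Letter) : abWord (.single x 1) = [x] := by
  cases x <;> simp [abWord]

theorem abWord_append {e e' : Letter →₀ ℕ} (h : e .b = 0 ∨ e' .a = 0) :
    abWord e ++ abWord e' = abWord (e + e') := by
  rcases h with h | h <;>
    simp [abWord, h, List.replicate_add, -List.replicate_append_replicate]

/-- The weighted language in which `a^n b^m` has the weight given by the coefficient of a power
series, and the words outside `a^* b^*` have weight zero. -/
def wordSeries : MvPowerSeries Letter R →ₗ[R] (List Letter → R) :=
  Function.ExtendByZero.linearMap R abWord

@[simp]
theorem wordSeries_abWord (g : MvPowerSeries Letter R) (e : Letter →₀ ℕ) :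
    wordSeries g (abWord e) = g.coeff e :=
  abWord_injective.extend_apply _ _ _

theorem wordSeries_nil (g : MvPowerSeries Letter R) :
    wordSeries g [] = MvPowerSeries.constantCoeff g :=
  wordSeries_abWord g 0

theorem exists_abWord_of_wordSeries_ne_zero {g : MvPowerSeries Letter R} {w : List Letter}
    (h : wordSeries g w ≠ 0) : ∃ e, abWord e = w :=
  not_imp_comm.1 (Function.extend_apply' _ _ _) h

theorem wordSeries_monomial [DecidableEq (List Letter)] (e : Letter →₀ ℕ) (r : R) :
    wordSeries (MvPowerSeries.monomial e r) = Pi.single (abWord e) r := by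
  classical
  funext w
  by_cases hw : ∃ e', abWord e' = w
  · obtain ⟨e', rfl⟩ := hw
    simp only [wordSeries_abWord, MvPowerSeries.coeff_monomial, Pi.single_apply,
      abWord_injective.eq_iff]
  · rw [not_imp_comm.1 exists_abWord_of_wordSeries_ne_zero hw, Pi.single_eq_of_ne]
    rintro rfl
    exact hw ⟨e, rfl⟩

theorem setOf_wordSeries_eq_one (g : MvPowerSeries Letter (ZMod 2)) :
    ({w | wordSeries g w = 1} : Language Letter) = (Dual.symm g).1 := by
  ext w
  change wordSeries g w = 1 ↔ ∃ e, abWord e = w ∧ g.coeff e = 1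
  constructor
  · intro h
    obtain ⟨e, rfl⟩ := exists_abWord_of_wordSeries_ne_zero (h.trans_ne one_ne_zero)
    exact ⟨e, rfl, by rwa [wordSeries_abWord] at h⟩
  · rintro ⟨e, rfl, h⟩
    rwa [wordSeries_abWord]

variable (R) in
/-- The power series in which only variables from `s` occur. -/
def supportedSeries {σ : Type*} (s : Set σ) : Subalgebra R (MvPowerSeries σ R) where
  carrier := {g | ∀ e, g.coeff e ≠ 0 → e ∈ Finsupp.supported ℕ ℕ s}
  add_mem' {g h} hg hh e he := by
    by_cases hge : g.coeff e = 0
    · exact hh e (by simpa [hge] using he)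
    · exact hg e hge
  mul_mem' {g h} hg hh e he := by
    classical
    rw [MvPowerSeries.coeff_mul] at he
    obtain ⟨d, hd, hne⟩ := Finset.exists_ne_zero_of_sum_ne_zero he
    rw [← Finset.HasAntidiagonal.mem_antidiagonal.1 hd]
    exact add_mem (hg _ (left_ne_zero_of_mul hne)) (hh _ (right_ne_zero_of_mul hne))
  algebraMap_mem' r e he := by
    classical
    rw [MvPowerSeries.algebraMap_apply, MvPowerSeries.coeff_C] at he
    rw [of_not_not fun h => he (if_neg h)]
    exact zero_mem _

theorem X_mem_supportedSeries {σ : Type*} (x : σ) :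
    MvPowerSeries.X x ∈ supportedSeries R {x} := by
  classical
  intro e he
  rw [MvPowerSeries.coeff_X] at he
  rw [of_not_not fun h => he (if_neg h)]
  exact Finsupp.single_mem_supported _ _ rfl

theorem subst_X_mem_supportedSeries {R σ : Type*} [CommRing R] (x : σ) (f : PowerSeries R) :
    PowerSeries.subst (MvPowerSeries.X x : MvPowerSeries σ R) f ∈ supportedSeries R {x} := by
  intro e he
  rw [PowerSeries.coeff_subst (.X x)] at he
  obtain ⟨d, hd⟩ := not_forall.1 fun h => he (finsum_eq_zero_of_forall_eq_zero h)
  exact pow_mem (X_mem_supportedSeries x) d e (right_ne_zero_of_smul hd)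

theorem apply_eq_zero_of_mem_supportedSeries {σ : Type*} {s : Set σ} {g : MvPowerSeries σ R}
    (hg : g ∈ supportedSeries R s) {e : σ →₀ ℕ} (he : g.coeff e ≠ 0) {x : σ} (hx : x ∉ s) :
    e x = 0 :=
  (Finsupp.mem_supported' _ _).1 (hg e he) x hx

-- The hypothesis excludes products of `b` by `a`, which commute as series but not as words.
theorem wordConv_wordSeries {g h : MvPowerSeries Letter R}
    (hgh : g ∈ supportedSeries R {.a} ∨ h ∈ supportedSeries R {.b}) :
    wordConv (wordSeries g) (wordSeries h) = wordSeries (g * h) := by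
  classical
  have happend {e e'} (hne : g.coeff e * h.coeff e' ≠ 0) :
      abWord e ++ abWord e' = abWord (e + e') := abWord_append <| hgh.imp
    (apply_eq_zero_of_mem_supportedSeries · (left_ne_zero_of_mul hne) (by simp))
    (apply_eq_zero_of_mem_supportedSeries · (right_ne_zero_of_mul hne) (by simp))
  have hsplit {p : List Letter × List Letter} (hp : wordSeries g p.1 * wordSeries h p.2 ≠ 0) :
      ∃ d : (Letter →₀ ℕ) × (Letter →₀ ℕ), (abWord d.1, abWord d.2) = p ∧
        g.coeff d.1 * h.coeff d.2 ≠ 0 := by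
    obtain ⟨u, v⟩ := p
    obtain ⟨e, rfl⟩ := exists_abWord_of_wordSeries_ne_zero (left_ne_zero_of_mul hp)
    obtain ⟨e', rfl⟩ := exists_abWord_of_wordSeries_ne_zero (right_ne_zero_of_mul hp)
    exact ⟨(e, e'), rfl, by simpa using hp⟩
  funext w
  by_cases hw : ∃ e, abWord e = w
  · obtain ⟨e, rfl⟩ := hw
    rw [wordSeries_abWord, MvPowerSeries.coeff_mul]
    symm
    refine Finset.sum_bij_ne_zero (fun d _ _ => (abWord d.1, abWord d.2)) ?_ ?_ ?_ ?_
    · intro d hd hne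
      rw [mem_wordAntidiagonal, happend hne, Finset.HasAntidiagonal.mem_antidiagonal.1 hd]
    · intro d _ _ d' _ _ heq
      exact Prod.ext (abWord_injective (Prod.mk.inj heq).1) (abWord_injective (Prod.mk.inj heq).2)
    · intro p hp hne
      obtain ⟨d, rfl, hd⟩ := hsplit hne
      rw [mem_wordAntidiagonal, happend hd] at hp
      exact ⟨d, Finset.HasAntidiagonal.mem_antidiagonal.2 (abWord_injective hp), hd, rfl⟩
    · simp
  · rw [not_imp_comm.1 exists_abWord_of_wordSeries_ne_zero hw]
    refine Finset.sum_eq_zero fun p hp => not_imp_comm.1 hsplit ?_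
    rintro ⟨d, rfl, hd⟩
    exact hw ⟨_, (happend hd).symm.trans (mem_wordAntidiagonal.1 hp)⟩

variable {N : Type*} {Φ : N → MvPowerSeries Letter R}

/-- The power series of a symbol, given those of the nonterminals. -/
def symbolSeries (Φ : N → MvPowerSeries Letter R) : Symbol Letter N → MvPowerSeries Letter R
  | .terminal x => MvPowerSeries.X x
  | .nonterminal A => Φ A

theorem symbolLanguage_wordSeries (X : Symbol Letter N) :
    symbolLanguage (wordSeries ∘ Φ) X = wordSeries (symbolSeries Φ X) := by
  classical
  cases X with
  | nonterminal A => rfl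
  | terminal x =>
    rw [symbolSeries, MvPowerSeries.X, wordSeries_monomial, abWord_single, symbolLanguage]
    congr!

/-- Of any two symbols of the string, the earlier one is a power series in `a` or the later one is
a power series in `b`, so that the words of these symbols, concatenated in order, form words of
`a^* b^*`. -/
def IsOrdered (Φ : N → MvPowerSeries Letter R) (α : List (Symbol Letter N)) : Prop :=
  α.Pairwise fun X Y =>
    symbolSeries Φ X ∈ supportedSeries R {.a} ∨ symbolSeries Φ Y ∈ supportedSeries R {.b}

theorem stringLanguage_wordSeries {α : List (Symbol Letter N)} (hα : IsOrdered Φ α) :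
    stringLanguage (wordSeries ∘ Φ) α = wordSeries (α.map (symbolSeries Φ)).prod := by
  classical
  induction α with
  | nil =>
    rw [List.map_nil, List.prod_nil, ← MvPowerSeries.monomial_zero_one, wordSeries_monomial,
      stringLanguage]
    rfl
  | cons X α ih =>
    obtain ⟨hX, hα⟩ := List.pairwise_cons.1 hα
    rw [stringLanguage, ih hα, symbolLanguage_wordSeries, List.map_cons, List.prod_cons]
    refine wordConv_wordSeries (or_iff_not_imp_left.2 fun hXa => list_prod_mem ?_)
    simpa using fun Y hY => (hX Y hY).resolve_left hXa

theorem isDescribedByGF2Grammar_of_series {N : Type} [Finite N] {ω : Symbol Letter N → ℤ} (S : N)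
    (rhs : N → List (Symbol Letter N) →₀ ZMod 2) {Φ : N → MvPowerSeries Letter (ZMod 2)}
    (hrhs : ∀ A, ∀ α ∈ (rhs A).support, totalWeight ω α < ω (.nonterminal A))
    (hord : ∀ A, ∀ α ∈ (rhs A).support, IsOrdered Φ α)
    (hbdd : IsWeightBounded ω (wordSeries ∘ Φ))
    (hΦ : ∀ A, Φ A = Finsupp.linearCombination (ZMod 2)
      (fun α => (α.map (symbolSeries Φ)).prod) (rhs A)) :
    IsDescribedByGF2Grammar (Dual.symm (Φ S) : Language Letter) := by
  rw [← setOf_wordSeries_eq_one]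
  refine isDescribedByGF2Grammar_of_solution S rhs hrhs hbdd fun A => ?_
  conv_lhs => rw [Function.comp_apply, hΦ A]
  simp only [Finsupp.linearCombination_apply, Finsupp.sum, map_sum, map_smul]
  exact Finset.sum_congr rfl fun α hα => by rw [stringLanguage_wordSeries (hord A α hα)]

end WordSeries

/-! ### Grammars for quotients -/

section ProperPart

open scoped PowerSeries

variable {σ R : Type*} [CommRing R]

/-- A power series in one variable without its constant term, as a power series in the variable
`x`. -/
def properPart (x : σ) (f : R⟦X⟧) : MvPowerSeries σ R :=
  f.subst (MvPowerSeries.X x : MvPowerSeries σ R) - MvPowerSeries.C (PowerSeries.constantCoeff f)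

theorem subst_X_eq_properPart_add (x : σ) (f : R⟦X⟧) :
    f.subst (MvPowerSeries.X x : MvPowerSeries σ R) =
      properPart x f + MvPowerSeries.C (PowerSeries.constantCoeff f) :=
  (sub_add_cancel _ _).symm

theorem properPart_mem_supportedSeries (x : σ) (f : R⟦X⟧) :
    properPart x f ∈ supportedSeries R {x} :=
  sub_mem (subst_X_mem_supportedSeries x f) (algebraMap_mem _ _)

theorem constantCoeff_properPart (x : σ) (f : R⟦X⟧) :
    MvPowerSeries.constantCoeff (properPart x f) = 0 := by
  rw [properPart, map_sub, MvPowerSeries.constantCoeff_C, PowerSeries.constantCoeff_subst (.X x),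
    finsum_eq_single _ 0 fun d hd => by simp [hd]]
  simp

theorem properPart_eq_of_eq_sq_add_X_mul_sq (x : σ) {f u v : (ZMod 2)⟦X⟧}
    (h : f = u ^ 2 + PowerSeries.X * v ^ 2) :
    properPart x f = properPart x u ^ 2 + MvPowerSeries.X x * properPart x v ^ 2 +
      MvPowerSeries.C (PowerSeries.constantCoeff v) * MvPowerSeries.X x := by
  have hx : PowerSeries.HasSubst (MvPowerSeries.X x : MvPowerSeries σ (ZMod 2)) := .X x
  have hsq (c : ZMod 2) : c ^ 2 = c := ZMod.pow_card c
  have : CharP (MvPowerSeries σ (ZMod 2)) 2 :=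
    charP_of_injective_algebraMap (algebraMap (ZMod 2) _).injective 2
  have hsubst : f.subst (MvPowerSeries.X x : MvPowerSeries σ (ZMod 2)) =
      u.subst (MvPowerSeries.X x) ^ 2 + MvPowerSeries.X x * v.subst (MvPowerSeries.X x) ^ 2 := by
    rw [h, PowerSeries.subst_add hx, PowerSeries.subst_mul hx, PowerSeries.subst_pow hx,
      PowerSeries.subst_pow hx, PowerSeries.subst_X hx]
  have hconst : PowerSeries.constantCoeff f = PowerSeries.constantCoeff u := by
    simp [h, hsq]
  simp only [subst_X_eq_properPart_add, CharTwo.add_sq, ← map_pow MvPowerSeries.C, hsq,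
    hconst] at hsubst
  linear_combination hsubst

end ProperPart

section QuotientGrammar

open scoped PowerSeries Polynomial

theorem coe_mul_eq_sum_support {R : Type*} [CommSemiring R] (q : MvPolynomial Letter R)
    (g : MvPowerSeries Letter R) :
    q * g = ∑ e ∈ q.support,
      q.coeff e • (MvPowerSeries.X .a ^ e .a * (g * MvPowerSeries.X .b ^ e .b)) := by
  have hmonomial (e : Letter →₀ ℕ) (c : R) : MvPowerSeries.monomial e c =
      c • (MvPowerSeries.X .a ^ e .a * MvPowerSeries.X .b ^ e .b) := by
    have he : .single .a (e .a) + .single .b (e .b) = e := by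
      ext x
      cases x <;> simp
    rw [MvPowerSeries.X_pow_eq, MvPowerSeries.X_pow_eq, MvPowerSeries.monomial_mul_monomial, he,
      ← map_smul, mul_one, smul_eq_mul, mul_one]
  have hq : (q : MvPowerSeries Letter R) =
      ∑ e ∈ q.support, MvPowerSeries.monomial e (q.coeff e) := by
    conv_lhs => rw [q.as_sum, ← MvPolynomial.coeToMvPowerSeries.ringHom_apply, map_sum]
    simp only [MvPolynomial.coeToMvPowerSeries.ringHom_apply, MvPolynomial.coe_monomial]
  rw [hq, Finset.sum_mul]
  refine Finset.sum_congr rfl fun e _ => ?_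
  rw [hmonomial, smul_mul_assoc, mul_assoc, mul_comm g]

/-- The nonterminals of a grammar for a series `g = ∑ Aᵢ(a) Bᵢ(b) + q g`: one for `g`, and for each
letter `x` and each `f` from a family of one-variable series indexed by `V`, one for `f(x)` and one
for `f(x) - f(0)`. -/
inductive QuotientNonterminal (V : Type)
  | start
  | full (x : Letter) (f : V)
  | proper (x : Letter) (f : V)

namespace QuotientNonterminal

variable {V : Type}

instance [Finite V] : Finite (QuotientNonterminal V) := by
  have : Finite Letter := .of_surjective (fun i : Bool => cond i .a .b) fun
    | .a => ⟨true, rfl⟩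
    | .b => ⟨false, rfl⟩
  refine .of_surjective (α := Option (Bool × Letter × V)) (fun
    | none => start
    | some (true, x, f) => full x f
    | some (false, x, f) => proper x f) ?_
  rintro (_ | ⟨x, f⟩ | ⟨x, f⟩)
  · exact ⟨none, rfl⟩
  · exact ⟨some (true, x, f), rfl⟩
  · exact ⟨some (false, x, f), rfl⟩

/-- Weights under which every rule is decreasing. Series without constant term have only words of
weight at most `-2`, so `proper` may have a negative weight; this allows for the quadratic rules
`proper x f → (proper x u)²`. -/
def weight : Symbol Letter (QuotientNonterminal V) → ℤ
  | .terminal _ => -2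
  | .nonterminal start => 3
  | .nonterminal (full _ _) => 1
  | .nonterminal (proper _ _) => -1

/-- The power series of the nonterminals. -/
def series (val : V → (ZMod 2)⟦X⟧) (g : MvPowerSeries Letter (ZMod 2)) :
    QuotientNonterminal V → MvPowerSeries Letter (ZMod 2)
  | start => g
  | full x f => (val f).subst (MvPowerSeries.X x : MvPowerSeries Letter (ZMod 2))
  | proper x f => properPart x (val f)

/-- The right-hand sides of the system for `g = ∑ Aᵢ(a) Bᵢ(b) + q g`, where every `f` in the family
satisfies `f = (u f)² + X (v f)²`. -/
def rules (val : V → (ZMod 2)⟦X⟧) (u v : V → V) {ι : Type*} [Fintype ι] (A B : ι → V)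
    (q : MvPolynomial Letter (ZMod 2)) :
    QuotientNonterminal V → List (Symbol Letter (QuotientNonterminal V)) →₀ ZMod 2
  | start =>
    ∑ i, .single [.nonterminal (full .a (A i)), .nonterminal (full .b (B i))] 1 +
    ∑ e ∈ q.support, .single (.replicate (e .a) (.terminal .a) ++
      .nonterminal start :: .replicate (e .b) (.terminal .b)) (q.coeff e)
  | full x f =>
    .single [.nonterminal (proper x f)] 1 + .single [] (PowerSeries.constantCoeff (val f))
  | proper x f =>
    .single [.nonterminal (proper x (u f)), .nonterminal (proper x (u f))] 1 +
    .single [.terminal x, .nonterminal (proper x (v f)), .nonterminal (proper x (v f))] 1 +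
    .single [.terminal x] (PowerSeries.constantCoeff (val (v f)))

variable (val : V → (ZMod 2)⟦X⟧) {u v : V → V} {ι : Type*} [Fintype ι] {A B : ι → V}
  {q : MvPolynomial Letter (ZMod 2)}

theorem isWeightBounded_series (g : MvPowerSeries Letter (ZMod 2)) :
    IsWeightBounded weight (wordSeries ∘ series val g) := by
  intro X w hw
  rcases w with _ | ⟨x, w⟩
  · rcases X with _ | ⟨y, f⟩ | ⟨y, f⟩
    · simp [weight]
    · simp [weight]
    · simp [series, wordSeries_nil, constantCoeff_properPart] at hw
  · have hlength : totalWeight (weight (V := V) ∘ .terminal) w = -2 * w.length := by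
      simp [totalWeight, Function.comp_def, weight, mul_comm]
    rcases X with _ | ⟨y, f⟩ | ⟨y, f⟩ <;>
      simp only [totalWeight_cons, Function.comp_apply, weight] <;> lia

theorem totalWeight_lt_of_mem_rules (hq : MvPolynomial.constantCoeff q = 0)
    (X : QuotientNonterminal V) :
    ∀ α ∈ (rules val u v A B q X).support, totalWeight weight α < weight (.nonterminal X) := by
  suffices rules val u v A B q X ∈
      Finsupp.supported (ZMod 2) (ZMod 2)
        {α | totalWeight weight α < weight (.nonterminal X)} from
    fun α hα => this hα
  rcases X with _ | ⟨x, f⟩ | ⟨x, f⟩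
  · refine add_mem (sum_mem fun i _ => ?_) (sum_mem fun e he => ?_) <;>
      refine Finsupp.single_mem_supported _ _ ?_
    · simp [weight]
    · have he₀ : e .a + e .b ≠ 0 := by
        intro h
        obtain rfl : e = 0 := Finsupp.ext fun
          | .a => by rw [Finsupp.zero_apply]; lia
          | .b => by rw [Finsupp.zero_apply]; lia
        exact MvPolynomial.mem_support_iff.1 he hq
      have hreplicate (n : ℕ) (x : Letter) :
          totalWeight (weight (V := V)) (.replicate n (.terminal x)) = -2 * n := by
        simp [totalWeight, weight, mul_comm]
      simp only [Set.mem_ofPred_eq, totalWeight_append, totalWeight_cons, hreplicate, weight]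
      lia
  · refine add_mem ?_ ?_ <;> exact Finsupp.single_mem_supported _ _ (by simp [weight])
  · refine add_mem (add_mem ?_ ?_) ?_ <;>
      exact Finsupp.single_mem_supported _ _ (by simp [weight])

theorem isOrdered_of_mem_rules (g : MvPowerSeries Letter (ZMod 2)) (X : QuotientNonterminal V) :
    ∀ α ∈ (rules val u v A B q X).support, IsOrdered (series val g) α := by
  suffices rules val u v A B q X ∈
      Finsupp.supported (ZMod 2) (ZMod 2) {α | IsOrdered (series val g) α} from
    fun α hα => this hα
  rcases X with _ | ⟨x, f⟩ | ⟨x, f⟩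
  · refine add_mem (sum_mem fun i _ => ?_) (sum_mem fun e _ => ?_) <;>
      refine Finsupp.single_mem_supported _ _ ?_
    · simp [IsOrdered, symbolSeries, series, subst_X_mem_supportedSeries]
    · simp [IsOrdered, symbolSeries, List.pairwise_append, List.pairwise_replicate,
        X_mem_supportedSeries]
  · refine add_mem ?_ ?_ <;> exact Finsupp.single_mem_supported _ _ (by simp [IsOrdered])
  · cases x <;> refine add_mem (add_mem ?_ ?_) ?_ <;>
      exact Finsupp.single_mem_supported _ _ (by
        simp [IsOrdered, symbolSeries, series, X_mem_supportedSeries,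
          properPart_mem_supportedSeries])

theorem series_eq_linearCombination_rules {g : MvPowerSeries Letter (ZMod 2)}
    (huv : ∀ f, val f = val (u f) ^ 2 + PowerSeries.X * val (v f) ^ 2)
    (hg : g = ∑ i, (val (A i)).subst (MvPowerSeries.X .a : MvPowerSeries Letter (ZMod 2)) *
      (val (B i)).subst (MvPowerSeries.X .b : MvPowerSeries Letter (ZMod 2)) + q * g)
    (X : QuotientNonterminal V) :
    series val g X = Finsupp.linearCombination (ZMod 2)
      (fun α => (α.map (symbolSeries (series val g))).prod) (rules val u v A B q X) := by
  rcases X with _ | ⟨x, f⟩ | ⟨x, f⟩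
  · rw [coe_mul_eq_sum_support] at hg
    simpa [rules, symbolSeries, series] using hg
  · simp [rules, symbolSeries, series, subst_X_eq_properPart_add x (val f),
      MvPowerSeries.smul_eq_C_mul]
  · simpa [rules, symbolSeries, series, MvPowerSeries.smul_eq_C_mul, sq] using
      properPart_eq_of_eq_sq_add_X_mul_sq x (huv f)

end QuotientNonterminal

theorem isDescribedByGF2Grammar_of_eq_sum_add_mul {ι : Type*} [Fintype ι] {A B : ι → (ZMod 2)⟦X⟧}
    (hA : ∀ i, IsAlgebraic (ZMod 2)[X] (A i)) (hB : ∀ i, IsAlgebraic (ZMod 2)[X] (B i))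
    {q : MvPolynomial Letter (ZMod 2)} (hq : MvPolynomial.constantCoeff q = 0)
    {g : MvPowerSeries Letter (ZMod 2)}
    (hg : g = ∑ i, (A i).subst (MvPowerSeries.X .a : MvPowerSeries Letter (ZMod 2)) *
      (B i).subst (MvPowerSeries.X .b : MvPowerSeries Letter (ZMod 2)) + q * g) :
    IsDescribedByGF2Grammar (Dual.symm g : Language Letter) := by
  obtain ⟨V, hfin, hmem, hV⟩ := exists_finite_mapsTo_cartier_of_finite (Sum.elim A B)
    (Sum.rec hA hB)
  rw [ZMod.card] at hV
  have : Finite V := hfin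
  have hcartier (f : V) := eq_sum_X_pow_mul_cartier_pow f.1
  simp only [ZMod.card, Finset.sum_range_succ, Finset.sum_range_zero, zero_add, pow_zero, one_mul,
    pow_one] at hcartier
  exact isDescribedByGF2Grammar_of_series .start
    (QuotientNonterminal.rules Subtype.val ((hV 0 (by simp)).restrict) ((hV 1 (by simp)).restrict)
      (fun i => ⟨A i, hmem (.inl i)⟩) (fun i => ⟨B i, hmem (.inr i)⟩) q)
    (QuotientNonterminal.totalWeight_lt_of_mem_rules _ hq)
    (QuotientNonterminal.isOrdered_of_mem_rules _ g)
    (QuotientNonterminal.isWeightBounded_series _ g)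
    (QuotientNonterminal.series_eq_linearCombination_rules _ hcartier hg)

end QuotientGrammar

end

theorem theorem5p1 (f : ABLaurentSeries) (hf : f ∈ Rint) :
    ∃ g : MvPowerSeries Letter (ZMod 2),
      algebraMap (MvPowerSeries Letter (ZMod 2)) ABLaurentSeries g = f ∧
      IsDescribedByGF2Grammar (Dual.symm g : Language Letter) := by
  obtain ⟨n, A, B, p, hA, hB, hp, rfl⟩ := hf
  choose A' hA' hAA' using hA
  choose B' hB' hBB' using hB
  have hp₀ : MvPowerSeries.constantCoeff (p : MvPowerSeries Letter (ZMod 2)) ≠ 0 :=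
    hp.trans_ne one_ne_zero
  have hinv := MvPowerSeries.mul_inv_cancel _ hp₀
  have hne : algebraMap _ ABLaurentSeries (p : MvPowerSeries Letter (ZMod 2)) ≠ 0 :=
    (map_ne_zero_iff _ (IsFractionRing.injective _ _)).2 fun h => hp₀ (by rw [h, map_zero])
  refine ⟨(∑ i, A i * B i) * (p : MvPowerSeries Letter (ZMod 2))⁻¹, ?_,
    isDescribedByGF2Grammar_of_eq_sum_add_mul hA' hB' (q := 1 - p) (by simp [hp]) ?_⟩
  · rw [eq_div_iff hne, ← map_mul, mul_assoc, mul_comm _⁻¹, hinv, mul_one]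
  · have hcoe : ((1 - p : MvPolynomial Letter (ZMod 2)) : MvPowerSeries Letter (ZMod 2)) =
        1 - p := by
      simpa using map_sub MvPolynomial.coeToMvPowerSeries.ringHom 1 p
    simp only [← hAA', ← hBB', hcoe]
    linear_combination (∑ i, A i * B i) * hinv
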